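/- Let $k,n$ be integers with $2\le k\le n-2$, and let $\mathcal I$ be the set of all $I\subset\{1,\dots,n\}$ with $\#I=k$. For $I\in\mathcal I$ let $\mathbb Z^k_I\subset\mathbb Z^n$ be the set of integer linear combinations of the canonical vectors $e_i$, $i\in I$, and let $\pi_I:\mathbb Z^n\to\mathbb Z^k_I$ be the orthogonal projection. Given $\mathbf p=(p_I)_{I\in\mathcal I}\in[0,1]^{\mathcal I}$, let $\omega_I=(\omega_I(u))_{u\in\mathbb Z^k_I}$, $I\in\mathcal I$, be independent families of independent $\{0,1\}$-valued random variables with $\mathbb P(\omega_I(u)=1)=p_I$, and let $\mathbb P_{\mathbf p}$ be the law on $\{0,1\}^{\mathbb Z^n}$ of $$\omega(v)=\prod_{I\in\mathcal I}\omega_I(\pi_I(v)),\qquad v\in\mathbb Z^n,$$ with expectation $\mathbb E_{\mathbf p}$. Write $o$ for the origin and $o\leftrightarrow\infty$ for the event that infinitely many sites of $\mathbb Z^n$ can be reached from $o$ by nearest-neighbour paths all of whose sites $v$ (endpoints included) satisfy $\omega(v)=1$. Then $\mathbb E_{\mathbf p}(\omega(o))=\prod_{I\in\mathcal I}p_I$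 for every $\mathbf p\in[0,1]^{\mathcal I}$, and there is $\delta=\delta(n,k)>0$ such that for every $\mathbf p\in[0,1]^{\mathcal I}$, $$\mathbb E_{\mathbf p}(\omega(o))>1-\delta\quad\Longrightarrow\quad \mathbb P_{\mathbf p}(o\leftrightarrow\infty)>0 .$$ -/

import Mathlib

namespace HyperplanePercolation

open MeasureTheory ProbabilityTheory

/-- The sites of the lattice `ℤⁿ`. -/
abbrev Site (n : ℕ) : Type := Fin n → ℤ

/-- The nearest-neighbour graph on `ℤⁿ`: two sites are adjacent iff their `ℓ¹`-distance
(equivalently, their Euclidean distance) is one. -/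
def lattice (n : ℕ) : SimpleGraph (Site n) where
  Adj x y := ∑ i, |x i - y i| = 1
  symm := ⟨fun x y h => by simpa only [abs_sub_comm] using h⟩
  loopless := ⟨fun x h => by simp at h⟩

/-- The family `𝓘(k; n)` of all subsets of `{1, …, n}` that have exactly `k` elements. -/
abbrev Index (n k : ℕ) : Type := {I : Finset (Fin n) // I.card = k}

/-- The coordinate hyperplane `ℤᵏ_I`: the integer combinations of the `e_i`, `i ∈ I`. -/
abbrev CoordPlane {n k : ℕ} (I : Index n k) : Type := {x : Site n // ∀ i, i ∉ I.1 → x i = 0}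

/-- The orthogonal projection `π_I : ℤⁿ → ℤᵏ_I`. -/
def proj {n k : ℕ} (I : Index n k) (v : Site n) : CoordPlane I :=
  ⟨fun i => if i ∈ I.1 then v i else 0, fun i hi => by simp [hi]⟩

/-- Configurations in `{0,1}^{ℤⁿ}`; `true` stands for `1` (open), `false` for `0` (removed). -/
abbrev Config (n : ℕ) : Type := Site n → Bool

/-- Families `(ω_I)_I` of configurations `ω_I ∈ {0,1}^{ℤᵏ_I}`. -/
abbrev PlaneConfig (n k : ℕ) : Type := (I : Index n k) → CoordPlane I → Bool

/-- The configuration `ω(v) = ∏_I ω_I(π_I(v))`: a product of elements of `{0,1}` is `1` iff every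
factor is (see `toNat_hyperplaneConfig` for the numerical product). -/
def hyperplaneConfig {n k : ℕ} (ξ : PlaneConfig n k) : Config n :=
  fun v => decide (∀ I : Index n k, ξ I (proj I v) = true)

theorem toNat_hyperplaneConfig {n k : ℕ} (ξ : PlaneConfig n k) (v : Site n) :
    (hyperplaneConfig ξ v).toNat = ∏ I : Index n k, (ξ I (proj I v)).toNat := by
  by_cases h : ∀ I : Index n k, ξ I (proj I v) = true
  · have h1 : hyperplaneConfig ξ v = true := by
      unfold hyperplaneConfig
      exact decide_eq_true h
    rw [h1, Finset.prod_eq_one (fun I _ => by rw [h I]; rfl)]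
    rfl
  · have h1 : hyperplaneConfig ξ v = false := by
      unfold hyperplaneConfig
      exact decide_eq_false h
    push Not at h
    obtain ⟨I, hI⟩ := h
    rw [h1, Finset.prod_eq_zero (Finset.mem_univ I)]
    · rfl
    · simpa using hI

theorem measurable_hyperplaneConfig {n k : ℕ} :
    Measurable (hyperplaneConfig : PlaneConfig n k → Config n) := by
  refine measurable_pi_lambda _ fun v => measurable_to_bool ?_
  have h : (fun ξ : PlaneConfig n k => hyperplaneConfig ξ v) ⁻¹' {true} =
      ⋂ I : Index n k, (fun ξ : PlaneConfig n k => ξ I (proj I v)) ⁻¹' {true} := by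
    ext ξ
    simp [hyperplaneConfig]
  rw [h]
  refine MeasurableSet.iInter fun I => ?_
  exact ((measurable_pi_apply (proj I v)).comp (measurable_pi_apply I)) (measurableSet_singleton _)

/-- Bernoulli site percolation on the vertex set `V` with parameter `q`: the law under which the
states of the sites are independent and each is `1` with probability `q`. -/
noncomputable def bernoulliSite (V : Type) (q : unitInterval) : Measure (V → Bool) :=
  Measure.infinitePi fun _ : V => bernoulliMeasure true false q

instance (V : Type) (q : unitInterval) : IsProbabilityMeasure (bernoulliSite V q) := by
  unfold bernoulliSite
  infer_instance

/-- The law `ℙ_𝐩` on `{0,1}^{ℤⁿ}` of Bernoulli `(n,k)`-hyperplane percolation: the image, under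
`(ω_I)_I ↦ ω`, of the product of the Bernoulli site percolations with parameters `p_I`. -/
noncomputable def hyperplaneLaw {n k : ℕ} (p : Index n k → unitInterval) : Measure (Config n) :=
  (Measure.pi fun I : Index n k => bernoulliSite (CoordPlane I) (p I)).map hyperplaneConfig

instance {n k : ℕ} (p : Index n k → unitInterval) : IsProbabilityMeasure (hyperplaneLaw p) :=
  Measure.isProbabilityMeasure_map measurable_hyperplaneConfig.aemeasurable

/-- `x ↔ y` in `ω`: some nearest-neighbour path from `x` to `y` has only open sites. -/
def Connects {n : ℕ} (ω : Config n) (x y : Site n) : Prop :=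
  ∃ w : (lattice n).Walk x y, w.IsPath ∧ ∀ z ∈ w.support, ω z = true

/-- The open cluster of `x` in `ω`. -/
def cluster {n : ℕ} (ω : Config n) (x : Site n) : Set (Site n) := {y | Connects ω x y}

/-- The event `o ↔ ∞`: the open cluster of the origin is infinite. -/
def originPercolates (n : ℕ) : Set (Config n) := {ω | (cluster ω 0).Infinite}

end HyperplanePercolation

namespace HyperplanePercolation

open MeasureTheory ProbabilityTheory

/-! ### Lipschitz percolation in the plane -/

/-! Restrict `ω` to the image of `ℤ²` under `z ↦ (z.1 + i * z.2)_i`, thickened by boxes, and call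
`z` bad if its box contains a closed site. Two distinct coordinates of the embedding determine `z`,
so as `2 ≤ k`, each site of a coordinate hyperplane influences boundedly many boxes. Hence bad
sites, though dependent, satisfy a product bound: all of `S` is bad with probability at most `η ^
S.card`, with `η` small when every `p I` is close to one (`measure_badBox_le`).

Such a bound suffices for Lipschitz percolation in the plane. Either the origin is the end of a path
from below height zero whose up steps enter bad sites, or some 1-Lipschitz graph through the origin
avoids bad sites (`exists_lipschitz_of_not_reached`). Counting paths gives the first alternative
probability less than one (`measure_reached_lt_one`). In the second, consecutive open boxes along
the graph overlap enough to form an infinite open cluster (`cluster_infinite_of_lipschitz`). -/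

/-- The site from which a path arrives at `z` by the step `s`: `none` is a step upwards, `some d` is
a step downwards with horizontal displacement `1 - d`. -/
def backStep (z : ℤ × ℤ) : Option (Fin 3) → ℤ × ℤ
  | none => (z.1, z.2 - 1)
  | some d => (z.1 + ((d : ℕ) : ℤ) - 1, z.2 + 1)

/-- The end point of the backward path from `z` with the given steps. -/
def backEnd (z : ℤ × ℤ) : List (Option (Fin 3)) → ℤ × ℤ
  | [] => z
  | s :: w => backEnd (backStep z s) w

/-- The sites of the backward path from `z` that are entered by a step upwards. -/
def upSites (z : ℤ × ℤ) : List (Option (Fin 3)) → List (ℤ × ℤ)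
  | [] => []
  | none :: w => z :: upSites (backStep z none) w
  | some d :: w => upSites (backStep z (some d)) w

/-- The backward path from `z` with steps `w` is admissible: it ends below height zero, and its steps
upwards enter bad sites. -/
def Admissible (bad : ℤ × ℤ → Prop) (z : ℤ × ℤ) (w : List (Option (Fin 3))) : Prop :=
  (backEnd z w).2 < 0 ∧ ∀ x ∈ upSites z w, bad x

/-- `z` is the end point of an admissible path. -/
def Reached (bad : ℤ × ℤ → Prop) (z : ℤ × ℤ) : Prop := ∃ w, Admissible bad z w

theorem backEnd_snd (z : ℤ × ℤ) (w : List (Option (Fin 3))) :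
    (backEnd z w).2 = z.2 + w.length - 2 * (upSites z w).length := by
  induction w generalizing z with
  | nil => simp [backEnd, upSites]
  | cons s w ih =>
    cases s with
    | none => simp [backEnd, upSites, ih, backStep]; ring
    | some d => simp [backEnd, upSites, ih, backStep]; ring

theorem Admissible.exists_of_mem_upSites {bad : ℤ × ℤ → Prop} {z x : ℤ × ℤ}
    {w : List (Option (Fin 3))} (h : Admissible bad z w) (hx : x ∈ upSites z w) :
    ∃ w', Admissible bad x w' ∧ w'.length ≤ w.length := by
  induction w generalizing z with
  | nil => simp [upSites] at hx
  | cons s w ih =>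
    cases s with
    | none =>
      rcases List.mem_cons.1 hx with rfl | hx
      · exact ⟨_, h, le_rfl⟩
      · obtain ⟨w', h1, h2⟩ := ih ⟨h.1, fun y hy => h.2 y (List.mem_cons_of_mem _ hy)⟩ hx
        exact ⟨w', h1, h2.trans (by simp)⟩
    | some d =>
      obtain ⟨w', h1, h2⟩ := ih ⟨h.1, h.2⟩ hx
      exact ⟨w', h1, h2.trans (by simp)⟩

/-- If an up site occurred twice, cutting out the loop between its visits would give a shorter
admissible path. -/
theorem Admissible.nodup_upSites {bad : ℤ × ℤ → Prop} {z : ℤ × ℤ} {w : List (Option (Fin 3))}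
    (h : Admissible bad z w) (hmin : ∀ w', Admissible bad z w' → w.length ≤ w'.length) :
    (upSites z w).Nodup := by
  induction w generalizing z with
  | nil => simp [upSites]
  | cons s w ih =>
    cases s with
    | none =>
      have h' : Admissible bad (backStep z none) w :=
        ⟨h.1, fun y hy => h.2 y (List.mem_cons_of_mem _ hy)⟩
      refine List.nodup_cons.2 ⟨fun hz => ?_, ih h' fun w' hw' => ?_⟩
      · obtain ⟨w', h1, h2⟩ := h'.exists_of_mem_upSites hz
        have := hmin w' h1
        simp only [List.length_cons] at this
        omega
      · have := hmin (none :: w') ⟨hw'.1, fun y hy => (List.mem_cons.1 hy).elim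
          (fun e => e ▸ h.2 z (by simp [upSites])) (hw'.2 y)⟩
        simpa using this
    | some d =>
      refine ih ⟨h.1, h.2⟩ fun w' hw' => ?_
      have := hmin (some d :: w') ⟨hw'.1, hw'.2⟩
      simpa using this

theorem Reached.exists_nodup {bad : ℤ × ℤ → Prop} {z : ℤ × ℤ} (h : Reached bad z) :
    ∃ w, Admissible bad z w ∧ (upSites z w).Nodup := by
  classical
  have hex : ∃ m, ∃ w, Admissible bad z w ∧ w.length = m := by
    obtain ⟨w, hw⟩ := h
    exact ⟨_, w, hw, rfl⟩
  obtain ⟨w, hw, hl⟩ := Nat.find_spec hex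
  exact ⟨w, hw, hw.nodup_upSites fun w' hw' => hl ▸ Nat.find_min' hex ⟨w', hw', rfl⟩⟩

theorem reached_of_neg {bad : ℤ × ℤ → Prop} {z : ℤ × ℤ} (h : z.2 < 0) : Reached bad z :=
  ⟨[], h, by simp [upSites]⟩

theorem Reached.up {bad : ℤ × ℤ → Prop} {a b : ℤ} (h : Reached bad (a, b - 1)) (hb : bad (a, b)) :
    Reached bad (a, b) := by
  obtain ⟨w, h1, h2⟩ := h
  refine ⟨none :: w, h1, fun y hy => ?_⟩
  rcases List.mem_cons.1 hy with rfl | hy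
  exacts [hb, h2 y hy]

theorem Reached.down {bad : ℤ × ℤ → Prop} {a a' b : ℤ} (h : Reached bad (a, b))
    (ha : |a' - a| ≤ 1) : Reached bad (a', b - 1) := by
  obtain ⟨w, h1, h2⟩ := h
  rw [abs_le] at ha
  have key : backStep (a', b - 1) (some ⟨(a - a' + 1).toNat, by omega⟩) = (a, b) := by
    have : ((a - a' + 1).toNat : ℤ) = a - a' + 1 := Int.toNat_of_nonneg (by omega)
    simp only [backStep, this, Prod.mk.injEq]
    exact ⟨by ring, by ring⟩
  refine ⟨some ⟨(a - a' + 1).toNat, by omega⟩ :: w, ?_, ?_⟩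
  · simpa only [backEnd, key] using h1
  · simpa only [upSites, key] using h2

theorem Reached.down_nat {bad : ℤ × ℤ → Prop} {a a' b : ℤ} (m : ℕ) (h : Reached bad (a, b))
    (ha : |a' - a| ≤ m) : Reached bad (a', b - m) := by
  induction m generalizing a b with
  | zero =>
    have : a' = a := by simpa [sub_eq_zero] using ha
    simpa [this] using h
  | succ m ih =>
    push_cast at ha ⊢
    rw [abs_le] at ha
    have key : ∃ c : ℤ, |c - a| ≤ 1 ∧ |a' - c| ≤ m := by
      rcases lt_trichotomy a a' with h0 | h0 | h0
      · exact ⟨a + 1, abs_le.2 ⟨by omega, by omega⟩, abs_le.2 ⟨by omega, by omega⟩⟩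
      · exact ⟨a, abs_le.2 ⟨by omega, by omega⟩, abs_le.2 ⟨by omega, by omega⟩⟩
      · exact ⟨a - 1, abs_le.2 ⟨by omega, by omega⟩, abs_le.2 ⟨by omega, by omega⟩⟩
    obtain ⟨c, h1, h2⟩ := key
    have := ih (h.down h1) h2
    rwa [show b - (m + 1) = b - 1 - m by ring] at *

/-- If no admissible path ends at the origin, then some Lipschitz function through the origin has a
graph without bad sites. -/
theorem exists_lipschitz_of_not_reached {bad : ℤ × ℤ → Prop} (h : ¬ Reached bad (0, 0)) :
    ∃ F : ℤ → ℤ, F 0 = 0 ∧ (∀ x, |F (x + 1) - F x| ≤ 1) ∧ ∀ x, ¬ bad (x, F x) := by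
  have hle : ∀ x b, Reached bad (x, b) → b < |x| := by
    intro x b hb
    by_contra! hlt
    have := hb.down_nat (a' := 0) (m := b.toNat)
      (by simp only [zero_sub, abs_neg]; omega)
    have h0 : (b.toNat : ℤ) = b := Int.toNat_of_nonneg ((abs_nonneg x).trans hlt)
    rw [h0, sub_self] at this
    exact h this
  have hlow : ∀ x b, ¬ Reached bad (x, b) → 0 ≤ b := fun x b hb => by
    by_contra! hlt
    exact hb (reached_of_neg hlt)
  -- `F x` is the lowest unreached height over `x`, so `(x, F x - 1)` is reached. A jump of `F`
  -- larger than one would let down steps from there reach the graph, and a bad site on the graph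
  -- would be reached by an up step.
  have hF : ∀ x : ℤ, ∃ b : ℤ, ¬ Reached bad (x, b) ∧ ∀ c, ¬ Reached bad (x, c) → b ≤ c :=
    fun x => Int.exists_least_of_bdd ⟨0, hlow x⟩ ⟨|x|, fun hx => lt_irrefl _ (hle x _ hx)⟩
  choose F hF1 hF2 using hF
  have hF3 : ∀ x, Reached bad (x, F x - 1) := fun x => by
    by_contra hx
    have := hF2 x _ hx
    omega
  have hstep : ∀ x y, |x - y| ≤ 1 → F x - 1 ≤ F y := fun x y hxy => by
    by_contra! hlt
    have h1 := (hF3 x).down_nat (a' := y) (m := (F x - 1 - F y).toNat)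
      (by rw [abs_sub_comm]; omega)
    rw [Int.toNat_of_nonneg (by omega)] at h1
    exact hF1 y (by simpa using h1)
  refine ⟨F, le_antisymm (hF2 0 0 h) (hlow 0 _ (hF1 0)), fun x => ?_, fun x hx => ?_⟩
  · have h1 := hstep x (x + 1) (by simp)
    have h2 := hstep (x + 1) x (by simp)
    exact abs_le.2 ⟨by omega, by omega⟩
  · exact hF1 x ((hF3 x).up hx)

/-! ### Counting backward paths -/

theorem measure_reached_lt_one {Ω : Type*} [MeasurableSpace Ω] (μ : Measure Ω)
    (bad : Ω → ℤ × ℤ → Prop) {r : ENNReal} (hr : 4 * r ≤ 4⁻¹)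
    (hbad : ∀ S : Finset (ℤ × ℤ), μ {ω | ∀ z ∈ S, bad ω z} ≤ r ^ (2 * S.card)) :
    μ {ω | Reached (bad ω) (0, 0)} < 1 := by
  classical
  have hr1 : r ≤ 1 := by
    calc r ≤ 4 * r := le_mul_of_one_le_left' (by norm_num)
      _ ≤ 4⁻¹ := hr
      _ ≤ 1 := by simp
  let E : List (Option (Fin 3)) → Set Ω := fun w => {ω | Admissible (bad ω) (0, 0) w ∧
    (upSites (0, 0) w).Nodup}
  have hE : ∀ w, μ (E w) ≤ r ^ w.length := by
    intro w
    by_cases hw : (backEnd (0, 0) w).2 < 0 ∧ (upSites (0, 0) w).Nodup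
    · calc μ (E w) ≤ μ {ω | ∀ z ∈ (upSites (0, 0) w).toFinset, bad ω z} :=
            measure_mono fun ω hω z hz => hω.1.2 z (List.mem_toFinset.1 hz)
        _ ≤ r ^ (2 * (upSites (0, 0) w).length) := by
            rw [← List.toFinset_card_of_nodup hw.2]
            exact hbad _
        _ ≤ r ^ w.length := by
            -- A path from below zero to height zero has more up steps than down steps, so its
            -- length is less than twice the number of up sites.
            refine pow_le_pow_right_of_le_one' hr1 ?_
            have := hw.1
            rw [backEnd_snd] at this
            simp only at this
            omega
    · have : E w = ∅ := Set.eq_empty_of_forall_notMem fun ω hω => hw ⟨hω.1.1, hω.2⟩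
      simp [this]
  -- The empty path is not admissible at height zero, so lengths start at one and the geometric
  -- series sums to `1/3`.
  have hsub : {ω | Reached (bad ω) (0, 0)} ⊆
      ⋃ m : ℕ, ⋃ w : List.Vector (Option (Fin 3)) (m + 1), E w.toList := by
    intro ω hω
    obtain ⟨w, hw, hn⟩ := Reached.exists_nodup hω
    obtain _ | ⟨s, w⟩ := w
    · simp [Admissible, backEnd] at hw
    · exact Set.mem_iUnion₂.2 ⟨w.length, ⟨s :: w, rfl⟩, hw, hn⟩
  calc μ {ω | Reached (bad ω) (0, 0)}
      ≤ ∑' m : ℕ, ∑' w : List.Vector (Option (Fin 3)) (m + 1), μ (E w.toList) :=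
        (measure_mono hsub).trans <| (measure_iUnion_le _).trans <|
          ENNReal.tsum_le_tsum fun m => measure_iUnion_le _
    _ ≤ ∑' m : ℕ, (4 : ENNReal)⁻¹ ^ (m + 1) := by
        refine ENNReal.tsum_le_tsum fun m => ?_
        calc ∑' w : List.Vector (Option (Fin 3)) (m + 1), μ (E w.toList)
            ≤ ∑' w : List.Vector (Option (Fin 3)) (m + 1), r ^ (m + 1) :=
              ENNReal.tsum_le_tsum fun w => (hE _).trans (by rw [w.toList_length])
          _ = (4 * r) ^ (m + 1) := by
              rw [tsum_fintype, Finset.sum_const, Finset.card_univ, card_vector, mul_pow]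
              simp
          _ ≤ _ := pow_le_pow_left' hr _
    _ < 1 := by
        rw [ENNReal.tsum_geometric_add_one]
        have h1 : (1 : ENNReal) - 4⁻¹ ≠ 0 := by
          rw [Ne, tsub_eq_zero_iff_le, not_le]
          exact ENNReal.inv_lt_one.2 (by norm_num)
        rw [← ENNReal.toReal_lt_toReal (by simp [ENNReal.mul_eq_top, h1]) (by simp)]
        rw [ENNReal.toReal_mul, ENNReal.toReal_inv, ENNReal.toReal_inv,
          ENNReal.toReal_sub_of_le (by simp) (by simp)]
        norm_num

/-! ### An embedded plane and its open boxes -/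

/-- A linear embedding of `ℤ²` into `ℤⁿ` any two coordinates of which are linearly independent. -/
def planeEmb (n : ℕ) (z : ℤ × ℤ) : Site n := fun i => z.1 + ((i : ℕ) : ℤ) * z.2

/-- The `ℓ^∞`-box of radius `n + 1` around the origin. -/
noncomputable def box (n : ℕ) : Finset (Site n) := Fintype.piFinset fun _ => Finset.Icc (-((n : ℤ) + 1)) (n + 1)

/-- Some site of the box around the image of `z` is closed. -/
def BadBox {n : ℕ} (ω : Config n) (z : ℤ × ℤ) : Prop :=
  ∃ b ∈ box n, ω (planeEmb n z + b) = false

theorem mem_box {n : ℕ} {b : Site n} : b ∈ box n ↔ ∀ i, |b i| ≤ n + 1 := by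
  simp [box, abs_le]

theorem connects_iff {n : ℕ} {ω : Config n} {x y : Site n} :
    Connects ω x y ↔ ∃ w : (lattice n).Walk x y, ∀ z ∈ w.support, ω z = true := by
  classical
  refine ⟨fun ⟨w, _, h⟩ => ⟨w, h⟩, fun ⟨w, h⟩ => ⟨w.bypass, w.bypass_isPath, fun z hz => ?_⟩⟩
  exact h z (w.support_bypass_subset_support hz)

theorem Connects.trans {n : ℕ} {ω : Config n} {x y z : Site n} (h : Connects ω x y)
    (h' : Connects ω y z) : Connects ω x z := by
  rw [connects_iff] at *
  obtain ⟨w, hw⟩ := h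
  obtain ⟨w', hw'⟩ := h'
  refine ⟨w.append w', fun u hu => ?_⟩
  rcases SimpleGraph.Walk.mem_support_append_iff _ _ |>.1 hu with hu | hu
  exacts [hw u hu, hw' u hu]

theorem connects_refl {n : ℕ} {ω : Config n} {x : Site n} (h : ω x = true) : Connects ω x x :=
  connects_iff.2 ⟨.nil, by simpa using h⟩

theorem connects_of_adj {n : ℕ} {ω : Config n} {x y : Site n} (h : (lattice n).Adj x y)
    (hx : ω x = true) (hy : ω y = true) : Connects ω x y :=
  connects_iff.2 ⟨.cons h .nil, by simp [hx, hy]⟩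

/-- Move a nonzero coordinate of `b` one unit towards zero and induct on the `ℓ¹`-norm; the path
stays in the box spanned by `b`. -/
theorem connects_of_box_open {n : ℕ} {ω : Config n} {a b : Site n}
    (h : ∀ v : Site n, (∀ i, |v i| ≤ |b i|) → ω (a + v) = true) : Connects ω a (a + b) := by
  classical
  induction hm : ∑ i, (b i).natAbs using Nat.strong_induction_on generalizing b with
  | _ m ih =>
    by_cases hb : b = 0
    · subst hb
      simpa using connects_refl (by simpa using h 0 (by simp))
    · obtain ⟨i, hi⟩ : ∃ i, b i ≠ 0 := by
        by_contra! hb'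
        exact hb (funext hb')
      let c : Site n := Function.update b i (b i - (b i).sign)
      have hci : c i = b i - (b i).sign := by simp [c]
      have hcj : ∀ j, j ≠ i → c j = b j := fun j hj => by simp [c, hj]
      have habs : |c i| + 1 = |b i| := by
        rw [hci]
        rcases lt_or_gt_of_ne hi with h0 | h0
        · rw [Int.sign_eq_neg_one_of_neg h0, abs_of_neg h0, abs_of_nonpos (by omega)]; ring
        · rw [Int.sign_eq_one_of_pos h0, abs_of_pos h0, abs_of_nonneg (by omega)]; ring
      have hle : ∀ j, |c j| ≤ |b j| := fun j => by
        by_cases hj : j = i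
        · subst hj; omega
        · rw [hcj j hj]
      have hlt : ∑ j, (c j).natAbs < m := by
        rw [← hm]
        refine Finset.sum_lt_sum (fun j _ => ?_) ⟨i, Finset.mem_univ _, ?_⟩
        · have := hle j
          rw [Int.abs_eq_natAbs, Int.abs_eq_natAbs] at this
          omega
        · rw [Int.abs_eq_natAbs, Int.abs_eq_natAbs] at habs
          omega
      refine (ih _ hlt (fun v hv => h v fun j => (hv j).trans (hle j)) rfl).trans ?_
      refine connects_of_adj ?_ (h c hle) (h b fun _ => le_rfl)
      change ∑ j, |(a + c) j - (a + b) j| = 1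
      rw [Finset.sum_eq_single i]
      · simp [hci, Int.abs_sign_of_ne_zero hi]
      · intro j _ hj
        simp [hcj j hj]
      · simp

theorem cluster_infinite_of_lipschitz {n : ℕ} (hn : 0 < n) {ω : Config n} {F : ℤ → ℤ}
    (h0 : F 0 = 0) (hF : ∀ x, |F (x + 1) - F x| ≤ 1) (hgood : ∀ x, ¬ BadBox ω (x, F x)) :
    (cluster ω 0).Infinite := by
  have hopen : ∀ x, ∀ b ∈ box n, ω (planeEmb n (x, F x) + b) = true := fun x b hb => by
    by_contra hne
    exact hgood x ⟨b, hb, by simpa using hne⟩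
  have hconn : ∀ m : ℕ, Connects ω 0 (planeEmb n ((m : ℤ), F m)) := by
    intro m
    induction m with
    | zero =>
      have hz : planeEmb n (((0 : ℕ) : ℤ), F ((0 : ℕ) : ℤ)) = 0 := by
        ext i
        simp [planeEmb, h0]
      have := hopen 0 0 (mem_box.2 fun i => by simp; positivity)
      rw [add_zero, ← Nat.cast_zero (R := ℤ), hz] at this
      rw [hz]
      exact connects_refl this
    | succ m ih =>
      refine ih.trans ?_
      have heq : planeEmb n (((m + 1 : ℕ) : ℤ), F ((m + 1 : ℕ) : ℤ)) = planeEmb n ((m : ℤ), F m) +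
          (planeEmb n (((m + 1 : ℕ) : ℤ), F ((m + 1 : ℕ) : ℤ)) - planeEmb n ((m : ℤ), F m)) := by
        abel
      rw [heq]
      refine connects_of_box_open fun v hv => hopen m v (mem_box.2 fun i => (hv i).trans ?_)
      have h1 : (planeEmb n (((m + 1 : ℕ) : ℤ), F ((m + 1 : ℕ) : ℤ)) -
          planeEmb n ((m : ℤ), F m)) i = 1 + ((i : ℕ) : ℤ) * (F (m + 1) - F m) := by
        simp only [planeEmb, Pi.sub_apply]
        push_cast
        ring
      rw [h1]
      -- A Lipschitz step displaces the embedded site by at most `1 + i` in coordinate `i`, which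
      -- the box radius `n + 1` covers.
      calc |1 + ((i : ℕ) : ℤ) * (F (m + 1) - F m)|
          ≤ |1| + |((i : ℕ) : ℤ) * (F (m + 1) - F m)| := abs_add_le _ _
        _ = 1 + ((i : ℕ) : ℤ) * |F (m + 1) - F m| := by simp [abs_mul]
        _ ≤ 1 + ((i : ℕ) : ℤ) * 1 := by gcongr; exact hF m
        _ ≤ n + 1 := by have := i.2; omega
  refine Set.infinite_of_injective_forall_mem (f := fun m : ℕ => planeEmb n ((m : ℤ), F m)) ?_ hconn
  intro m m' h
  have := congrFun h ⟨0, hn⟩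
  simpa [planeEmb] using this

/-! ### Probability of bad boxes -/

theorem pi_bernoulliSite_forall {n k : ℕ} (p : Index n k → unitInterval) (b : Bool)
    (T : (I : Index n k) → Finset (CoordPlane I)) :
    (Measure.pi fun I : Index n k => bernoulliSite (CoordPlane I) (p I))
      {ξ | ∀ I, ∀ u ∈ T I, ξ I u = b} =
    ∏ I, bernoulliMeasure true false (p I) {b} ^ (T I).card := by
  have h : {ξ : PlaneConfig n k | ∀ I, ∀ u ∈ T I, ξ I u = b} =
      Set.univ.pi fun I => Set.pi (T I) fun _ => {b} := by
    ext ξ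
    simp [Set.mem_pi]
  rw [h, Measure.pi_pi]
  refine Finset.prod_congr rfl fun I _ => ?_
  rw [bernoulliSite, Measure.infinitePi_pi _ (fun _ _ => measurableSet_singleton _),
    Finset.prod_const]

theorem integral_toNat_zero {n k : ℕ} (p : Index n k → unitInterval) :
    ∫ ω, ((ω 0).toNat : ℝ) ∂(hyperplaneLaw p) = ∏ I, (p I : ℝ) := by
  have hm : Measurable fun ω : Config n => ((ω 0).toNat : ℝ) :=
    (Measurable.of_discrete (f := fun b : Bool => (b.toNat : ℝ))).comp (measurable_pi_apply 0)
  rw [hyperplaneLaw, integral_map measurable_hyperplaneConfig.aemeasurable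
    hm.aestronglyMeasurable]
  have hset := pi_bernoulliSite_forall p true fun I => {proj I 0}
  have hms : MeasurableSet {ξ : PlaneConfig n k | hyperplaneConfig ξ 0 = true} :=
    ((measurable_pi_apply 0).comp measurable_hyperplaneConfig) (measurableSet_singleton true)
  have hind : (fun ξ : PlaneConfig n k => ((hyperplaneConfig ξ 0).toNat : ℝ)) =
      Set.indicator {ξ : PlaneConfig n k | hyperplaneConfig ξ 0 = true} 1 := by
    ext ξ
    by_cases h : hyperplaneConfig ξ 0 = true <;> simp [h]
  rw [hind, integral_indicator_one hms, measureReal_def]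
  have heq : {ξ : PlaneConfig n k | hyperplaneConfig ξ 0 = true} =
      {ξ | ∀ I, ∀ u ∈ ({proj I 0} : Finset (CoordPlane I)), ξ I u = true} := by
    ext ξ
    simp [hyperplaneConfig]
  rw [heq, hset, ENNReal.toReal_prod]
  refine Finset.prod_congr rfl fun I _ => ?_
  rw [Finset.card_singleton, pow_one, ← measureReal_def,
    bernoulliMeasure_real_apply _ (measurableSet_singleton _)]
  simp

/-- The site of the coordinate hyperplanes that is used by the box of `z` at the position `c`. -/
def baseSite {n k : ℕ} (z : ℤ × ℤ) (c : Index n k × Site n) : Σ I : Index n k, CoordPlane I :=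
  ⟨c.1, proj c.1 (planeEmb n z + c.2)⟩

theorem BadBox.exists_baseSite {n k : ℕ} {ξ : PlaneConfig n k} {z : ℤ × ℤ}
    (h : BadBox (hyperplaneConfig ξ) z) :
    ∃ c ∈ (Finset.univ : Finset (Index n k)) ×ˢ box n,
      ξ (baseSite z c).1 (baseSite z c).2 = false := by
  obtain ⟨b, hb, h⟩ := h
  rw [hyperplaneConfig, decide_eq_false_iff_not] at h
  push Not at h
  obtain ⟨I, hI⟩ := h
  exact ⟨(I, b), by simpa using hb, by simpa [baseSite] using hI⟩

/-- Two coordinates `i ≠ j` in `I` confine two independent linear forms of `z` (determinant `± (i -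
j)`) to intervals of `2 * n + 3` integers each. -/
theorem card_filter_baseSite_le {n k : ℕ} (hk : 2 ≤ k) (S : Finset (ℤ × ℤ))
    (c : ℤ × ℤ → Index n k × Site n) (hc : ∀ z ∈ S, (c z).2 ∈ box n)
    (v : Σ I : Index n k, CoordPlane I) [DecidableEq (Σ I : Index n k, CoordPlane I)] :
    (S.filter fun z => baseSite z (c z) = v).card ≤ (2 * n + 3) ^ 2 := by
  obtain ⟨I, u⟩ := v
  obtain ⟨i, hi, j, hj, hij⟩ := Finset.one_lt_card.1 (show 1 < I.1.card by rw [I.2]; omega)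
  let B : Finset ℤ := Finset.Icc (-((n : ℤ) + 1)) (n + 1)
  have hB : B.card = 2 * n + 3 := by
    simp only [B, Int.card_Icc]
    omega
  have hcoord : ∀ z, z ∈ S.filter (fun z => baseSite z (c z) = ⟨I, u⟩) → ∀ l ∈ I.1,
      u.1 l - planeEmb n z l ∈ B := by
    intro z hz l hl
    obtain ⟨hzS, hz⟩ := Finset.mem_filter.1 hz
    have hI : (c z).1 = I := congrArg Sigma.fst hz
    have h1 : (baseSite z (c z)).2.1 l = u.1 l := by rw [hz]
    have h2 : (baseSite z (c z)).2.1 l = planeEmb n z l + (c z).2 l := by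
      simp [baseSite, proj, hI, hl]
    have h3 := abs_le.1 (mem_box.1 (hc z hzS) l)
    exact Finset.mem_Icc.2 ⟨by omega, by omega⟩
  calc (S.filter fun z => baseSite z (c z) = ⟨I, u⟩).card ≤ (B ×ˢ B).card := by
        refine Finset.card_le_card_of_injOn
          (fun z => (u.1 i - planeEmb n z i, u.1 j - planeEmb n z j)) (fun z hz => ?_) ?_
        · exact Finset.mem_product.2 ⟨hcoord z hz i hi, hcoord z hz j hj⟩
        · intro z _ z' _ h
          have hij' : ((i : ℕ) : ℤ) - ((j : ℕ) : ℤ) ≠ 0 := by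
            rw [sub_ne_zero]
            exact_mod_cast fun h => hij (Fin.ext h)
          have h1 : z.1 + ((i : ℕ) : ℤ) * z.2 = z'.1 + ((i : ℕ) : ℤ) * z'.2 := by
            simpa [planeEmb] using (Prod.ext_iff.1 h).1
          have h2 : z.1 + ((j : ℕ) : ℤ) * z.2 = z'.1 + ((j : ℕ) : ℤ) * z'.2 := by
            simpa [planeEmb] using (Prod.ext_iff.1 h).2
          have h3 : z.2 = z'.2 := mul_left_cancel₀ hij' (by linear_combination h1 - h2)
          refine Prod.ext ?_ h3
          rw [h3] at h1
          exact add_right_cancel h1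
    _ = (2 * n + 3) ^ 2 := by rw [Finset.card_product, hB, sq]

/-- A union bound over the choice of one closed base site for each `z ∈ S`. A choice involves at
least `S.card / (2 * n + 3) ^ 2` distinct, independent base sites; the exponent in `hp` compensates
for this loss. -/
theorem measure_badBox_le {n k : ℕ} (hk : 2 ≤ k) (p : Index n k → unitInterval) {ε : ENNReal}
    (hε : ε ≤ 1)
    (hp : ∀ I, bernoulliMeasure true false (p I) {false} ≤ ε ^ ((2 * n + 3) ^ 2))
    (S : Finset (ℤ × ℤ)) :
    (Measure.pi fun I : Index n k => bernoulliSite (CoordPlane I) (p I))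
      {ξ | ∀ z ∈ S, BadBox (hyperplaneConfig ξ) z} ≤
    ((Fintype.card (Index n k) * (box n).card : ℕ) * ε) ^ S.card := by
  classical
  set μ := Measure.pi fun I : Index n k => bernoulliSite (CoordPlane I) (p I)
  let C : Finset (Index n k × Site n) := Finset.univ ×ˢ box n
  have hdet : ∀ T : Finset (Σ I : Index n k, CoordPlane I),
      μ {ξ | ∀ v ∈ T, ξ v.1 v.2 = false} ≤ ε ^ ((2 * n + 3) ^ 2 * T.card) := by
    intro T
    let T' : (I : Index n k) → Finset (CoordPlane I) := fun I =>
      T.preimage (Sigma.mk I) (sigma_mk_injective.injOn)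
    have hT : T = Finset.univ.sigma T' := by
      ext ⟨I, u⟩
      simp [T']
    have hcard : T.card = ∑ I, (T' I).card := by
      conv_lhs => rw [hT]
      exact Finset.card_sigma _ _
    have heq : {ξ : PlaneConfig n k | ∀ v ∈ T, ξ v.1 v.2 = false} =
        {ξ | ∀ I, ∀ u ∈ T' I, ξ I u = false} := by
      ext ξ
      simp [T', Sigma.forall]
    rw [heq, pi_bernoulliSite_forall, pow_mul, hcard, ← Finset.prod_pow_eq_pow_sum]
    exact Finset.prod_le_prod' fun I _ => pow_le_pow_left' (hp I) _
  have hfix : ∀ c ∈ S.pi fun _ => C,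
      μ {ξ | ∀ z, ∀ hz : z ∈ S,
        ξ (baseSite z (c z hz)).1 (baseSite z (c z hz)).2 = false} ≤ ε ^ S.card := by
    intro c hc
    rcases S.eq_empty_or_nonempty with rfl | ⟨z₀, hz₀⟩
    · simp only [Finset.card_empty, pow_zero]
      exact prob_le_one
    -- The value off `S` is immaterial; it only makes the choice a plain function.
    let c' : ℤ × ℤ → Index n k × Site n := fun z => if hz : z ∈ S then c z hz else c z₀ hz₀
    have hc' : ∀ z (hz : z ∈ S), c' z = c z hz := fun z hz => by simp [c', hz]
    have hmem : ∀ z ∈ S, (c' z).2 ∈ box n := fun z hz => by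
      rw [hc' z hz]
      exact (Finset.mem_product.1 (Finset.mem_pi.1 hc z hz)).2
    let T := S.image fun z => baseSite z (c' z)
    calc _ ≤ μ {ξ | ∀ v ∈ T, ξ v.1 v.2 = false} := by
          refine measure_mono fun ξ hξ v hv => ?_
          obtain ⟨z, hz, rfl⟩ := Finset.mem_image.1 hv
          rw [hc' z hz]
          exact hξ z hz
      _ ≤ ε ^ ((2 * n + 3) ^ 2 * T.card) := hdet T
      _ ≤ ε ^ S.card := pow_le_pow_right_of_le_one' hε <|
          Finset.card_le_mul_card_image S _ fun v _ => card_filter_baseSite_le hk S c' hmem v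
  have hsub : {ξ | ∀ z ∈ S, BadBox (hyperplaneConfig ξ) z} ⊆
      ⋃ c ∈ S.pi fun _ => C, {ξ : PlaneConfig n k | ∀ z, ∀ hz : z ∈ S,
        ξ (baseSite z (c z hz)).1 (baseSite z (c z hz)).2 = false} := by
    intro ξ hξ
    choose c hc1 hc2 using fun z hz => (hξ z hz).exists_baseSite
    exact Set.mem_iUnion₂.2 ⟨c, Finset.mem_pi.2 hc1, hc2⟩
  calc μ {ξ | ∀ z ∈ S, BadBox (hyperplaneConfig ξ) z}
      ≤ ∑ c ∈ S.pi fun _ => C, μ {ξ : PlaneConfig n k | ∀ z, ∀ hz : z ∈ S,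
        ξ (baseSite z (c z hz)).1 (baseSite z (c z hz)).2 = false} :=
        (measure_mono hsub).trans (measure_biUnion_finset_le _ _)
    _ ≤ ∑ c ∈ S.pi fun _ => C, ε ^ S.card := Finset.sum_le_sum hfix
    _ = _ := by
        rw [Finset.sum_const, Finset.card_pi, Finset.prod_const, nsmul_eq_mul, mul_pow]
        simp [C, Finset.card_product]

end HyperplanePercolation

/-! ### Choice of constants and conclusion -/

theorem mainTheorem4 (n k : ℕ) (hk : 2 ≤ k) (hkn : k + 2 ≤ n) :
    (∀ p : HyperplanePercolation.Index n k → unitInterval,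
      ∫ ω, ((ω 0).toNat : ℝ) ∂(HyperplanePercolation.hyperplaneLaw p) = ∏ I, (p I : ℝ)) ∧
    ∃ δ : ℝ, 0 < δ ∧ ∀ p : HyperplanePercolation.Index n k → unitInterval,
      1 - δ < ∫ ω, ((ω 0).toNat : ℝ) ∂(HyperplanePercolation.hyperplaneLaw p) →
        0 < HyperplanePercolation.hyperplaneLaw p (HyperplanePercolation.originPercolates n) := by
  open HyperplanePercolation MeasureTheory ProbabilityTheory in
  refine ⟨integral_toNat_zero, ?_⟩
  let M : ℕ := Fintype.card (Index n k) * (box n).card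
  -- This makes `M * ε ≤ 1 / 256 = (1 / 16) ^ 2`, the bound per bad site needed for `r = 1 / 16`.
  let ε : ℝ := 1 / (256 * (M + 1))
  have hε0 : 0 < ε := by positivity
  have hε1 : ε ≤ 1 := by
    rw [div_le_one (by positivity)]
    linarith [(Nat.cast_nonneg M : (0 : ℝ) ≤ M)]
  refine ⟨ε ^ ((2 * n + 3) ^ 2), by positivity, fun p hp => ?_⟩
  rw [integral_toNat_zero] at hp
  have hpI : ∀ I, bernoulliMeasure true false (p I) {false} ≤
      ENNReal.ofReal ε ^ ((2 * n + 3) ^ 2) := by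
    intro I
    -- The product is at most each factor, so every `1 - p I` is below `δ`.
    have h1 : ∏ J, (p J : ℝ) ≤ p I := by
      rw [← Finset.mul_prod_erase _ _ (Finset.mem_univ I)]
      exact mul_le_of_le_one_right (p I).2.1
        (Finset.prod_le_one (fun J _ => (p J).2.1) fun J _ => (p J).2.2)
    rw [← ENNReal.ofReal_pow hε0.le]
    refine (ENNReal.le_ofReal_iff_toReal_le (measure_ne_top _ _) (by positivity)).2 ?_
    rw [← measureReal_def, bernoulliMeasure_real_apply _ (measurableSet_singleton _)]
    simp
    linarith
  have hr : (4 : ENNReal) * ENNReal.ofReal (1 / 16) ≤ 4⁻¹ := by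
    rw [← ENNReal.toReal_le_toReal (by finiteness) (by simp)]
    rw [ENNReal.toReal_mul, ENNReal.toReal_ofReal (by norm_num), ENNReal.toReal_inv]
    norm_num
  have hlt := measure_reached_lt_one
    (Measure.pi fun I : Index n k => bernoulliSite (CoordPlane I) (p I))
    (fun ξ => BadBox (hyperplaneConfig ξ)) hr fun S => by
      refine (measure_badBox_le hk p (ENNReal.ofReal_le_one.2 hε1) hpI S).trans ?_
      rw [pow_mul]
      refine pow_le_pow_left' ?_ _
      rw [← ENNReal.ofReal_natCast, ← ENNReal.ofReal_mul (by positivity),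
        ← ENNReal.ofReal_pow (by norm_num)]
      refine ENNReal.ofReal_le_ofReal ?_
      change (M : ℝ) * (1 / (256 * (M + 1))) ≤ _
      rw [mul_one_div, div_le_iff₀ (by positivity)]
      linarith
  -- This inequality for image measures holds for arbitrary sets, so measurability of
  -- `originPercolates n` is not needed.
  refine lt_of_lt_of_le ?_
    (Measure.le_map_apply measurable_hyperplaneConfig.aemeasurable (originPercolates n))
  set μ := Measure.pi fun I : Index n k => bernoulliSite (CoordPlane I) (p I)
  by_contra! h0
  have hsub : (Set.univ : Set (PlaneConfig n k)) ⊆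
      {ξ | Reached (BadBox (hyperplaneConfig ξ)) (0, 0)} ∪
        hyperplaneConfig ⁻¹' originPercolates n := by
    intro ξ _
    by_cases h : Reached (BadBox (hyperplaneConfig ξ)) (0, 0)
    · exact Or.inl h
    · obtain ⟨F, hF0, hF1, hF2⟩ := exists_lipschitz_of_not_reached h
      exact Or.inr (cluster_infinite_of_lipschitz (by omega) hF0 hF1 hF2)
  have h1 : (1 : ENNReal) ≤ μ {ξ | Reached (BadBox (hyperplaneConfig ξ)) (0, 0)} := by
    calc (1 : ENNReal) = μ Set.univ := measure_univ.symm
      _ ≤ _ := (measure_mono hsub).trans (measure_union_le _ _)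
      _ ≤ _ := by rw [nonpos_iff_eq_zero.1 h0, add_zero]
  exact absurd hlt h1.not_gt
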